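/- Write $[x,y]=x^{-1}y^{-1}xy$. Outer commutator words are defined inductively: a variable $x_i$ is one, and if $u,v$ are outer commutator words in disjoint sets of variables, then $[u,v]$ is one. Let $w=w(x_1,\dots,x_r)$ be an outer commutator word, let $\mathcal W$ be the variety it defines, and let $\mathcal V$ be the variety defined by the word $v=[[w,x_{r+1}],x_{r+2}]$, where $x_{r+1},x_{r+2}$ are two further variables. For a group $H$ let $T(H)$ be the set of all values of $v$ in $H$, let $V(H)=\langle T(H)\rangle$ and $W(H)$ be the verbal subgroups of $v$ and $w$, and let $V^*(H)$ be the marginal subgroup, i.e. the set of all $a\in H$ such that multiplying any one argument of $v$ by $a$ never changes its value. For a free presentation $H\cong F/R$ put $$\mathcal V\tilde B_0(H)=\frac{R\cap V(F)}{\langle T(F)\cap R\rangle},$$ an abelian group that does not depend, up to isomorphism, on the presentation. A VP cover of $G$ is an extension $1\to L\xrightarrow{\chi} G^*\to G\to 1$ such that $\chi(L)\subseteq V^*(G^*)\cap V(G^*)$, $L\cong\mathcal V\tilde B_0(G)$, and whenever $v(g_1,\dots,g_{r+2})=1$ for elements $g_i$ of $G$, there are lifts $\tilde g_i\in G^*$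 of the $g_i$ with $v(\tilde g_1,\dots,\tilde g_{r+2})=1$. **Corollary 3.5.** Let $G$ be a finite group, let $p$ be a prime and let $G_p$ be a Sylow $p$-subgroup of $G$. Let $1\to L\to G^*\to G\to 1$ be a VP cover of $G$ (regard $L$ as a subgroup of $G^*$), and let $B$ be a subgroup of $G^*$ with $L\le B$ and $B/L\cong G_p$. Identify $\mathcal V\tilde B_0(G)$ with $L$ by any isomorphism, so that its Sylow $p$-subgroup $\mathcal V\tilde B_0(G)_p$ becomes a subgroup of $G^*$. Then the subgroup $[W(B),\mathcal V\tilde B_0(G)_p]$ of $G^*$ is isomorphic to a subgroup of $\mathcal V\tilde B_0(G_p)$. -/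

import Mathlib

namespace BTilde

/-- The commutator convention `[x, y] = x⁻¹ y⁻¹ x y`. -/
def comm {G : Type*} [Group G] (x y : G) : G := x⁻¹ * y⁻¹ * x * y

/-- `IsOuterCommutatorWord S w`: the element `w` of the free group on `x₀, x₁, …` is an outer
commutator word, and `S` is the set of indices of the variables that occur in it (so its weight is
`S.card`).  A single variable is such a word, and so is the commutator of two such words that have
no variable in common. -/
inductive IsOuterCommutatorWord : Finset ℕ → FreeGroup ℕ → Prop
  | var (i : ℕ) : IsOuterCommutatorWord {i} (FreeGroup.of i)
  | comm {S T : Finset ℕ} {u v : FreeGroup ℕ} (hu : IsOuterCommutatorWord S u)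
      (hv : IsOuterCommutatorWord T v) (hST : Disjoint S T) :
      IsOuterCommutatorWord (S ∪ T) (BTilde.comm u v)

section Words

variable (V : Set (FreeGroup ℕ)) (G : Type*) [Group G]

/-- `T(G)`: the set of all values in `G` of the words in `V`.  The value of the word `v` at the
sequence `g` is `FreeGroup.lift g v`. -/
def wordValues : Set G := {x | ∃ v ∈ V, ∃ g : ℕ → G, FreeGroup.lift g v = x}

/-- The verbal subgroup `V(G)`. -/
def verbalSubgroup : Subgroup G := Subgroup.closure (wordValues V G)

/-- The marginal subgroup `V*(G)`: all `a` such that multiplying any one argument of any word in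
`V` by `a` never changes the value. -/
def marginalSubgroup : Subgroup G where
  carrier := {a | ∀ v ∈ V, ∀ (g : ℕ → G) (i : ℕ),
    FreeGroup.lift (Function.update g i (g i * a)) v = FreeGroup.lift g v}
  one_mem' := by
    intro v _ g i
    simp
  mul_mem' := by
    intro a b ha hb v hv g i
    have h := hb v hv (Function.update g i (g i * a)) i
    simp only [Function.update_self, Function.update_idem, mul_assoc] at h
    rw [h, ha v hv g i]
  inv_mem' := by
    intro a ha v hv g i
    have h := ha v hv (Function.update g i (g i * a⁻¹)) i
    simp only [Function.update_self, Function.update_idem, inv_mul_cancel_right,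
      Function.update_eq_self] at h
    exact h.symm

end Words

/-- For a group homomorphism `π : F → G` with kernel `R`, the subgroup `⟨T(F) ∩ R⟩` of `F`. -/
def trivialValues (V : Set (FreeGroup ℕ)) {F G : Type*} [Group F] [Group G] (π : F →* G) :
    Subgroup F :=
  Subgroup.closure (wordValues V F ∩ (π.ker : Set F))

instance trivialValues_normal (V : Set (FreeGroup ℕ)) {F G : Type*} [Group F] [Group G]
    (π : F →* G) : (trivialValues V π).Normal := by
  refine ⟨fun n hn g => ?_⟩
  refine Subgroup.closure_induction (p := fun x _ => g * x * g⁻¹ ∈ trivialValues V π)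
    ?_ ?_ ?_ ?_ hn
  · rintro x ⟨⟨v, hv, f, rfl⟩, hx⟩
    refine Subgroup.subset_closure ⟨⟨v, hv, fun i => g * f i * g⁻¹, ?_⟩, ?_⟩
    · have h : FreeGroup.lift (fun i => g * f i * g⁻¹)
          = (MulAut.conj g).toMonoidHom.comp (FreeGroup.lift f) := by
        ext i
        simp
      rw [h]
      simp
    · exact (MonoidHom.normal_ker π).conj_mem _ hx g
  · simp
  · intro x y _ _ hx hy
    have h := mul_mem hx hy
    simpa [mul_assoc] using h
  · intro x _ hx
    have h := inv_mem hx
    simpa [mul_assoc] using h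

/-- The canonical free presentation of `G`: the free group on the set `G`, mapped onto `G`. -/
abbrev presentation (G : Type*) [Group G] : FreeGroup G →* G := FreeGroup.lift id

/-- The `B̃₀`-invariant `(R ∩ V(F)) / ⟨T(F) ∩ R⟩` of `G` with respect to the variety defined by the
laws `V`, computed from the canonical free presentation `G ≅ F / R`.  (For outer commutator words
it does not depend on the presentation, up to isomorphism.) -/
abbrev Invariant (V : Set (FreeGroup ℕ)) (G : Type*) [Group G] : Type _ :=
  ↥((presentation G).ker ⊓ verbalSubgroup V (FreeGroup G)) ⧸
    (trivialValues V (presentation G)).subgroupOf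
      ((presentation G).ker ⊓ verbalSubgroup V (FreeGroup G))

section Extensions

variable (V : Set (FreeGroup ℕ)) {N E Q : Type*} [Group N] [Group E] [Group Q]

/-- The extension `1 → N → E → Q → 1` is a VP extension: whenever a word in `V` is trivial at
elements of `Q`, these elements can be lifted to `E` so that the word is trivial at the lifts. -/
def IsVPExtension (S : GroupExtension N E Q) : Prop :=
  ∀ v ∈ V, ∀ q : ℕ → Q, FreeGroup.lift q v = 1 →
    ∃ e : ℕ → E, (∀ i, S.rightHom (e i) = q i) ∧ FreeGroup.lift e v = 1

/-- A VP cover: a marginal VP extension `1 → N → E → Q → 1` that is `V`-stem and whose kernel is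
isomorphic to the `B̃₀`-invariant of `Q`. -/
structure IsVPCover (S : GroupExtension N E Q) : Prop where
  vp : IsVPExtension V S
  marginal : S.inl.range ≤ marginalSubgroup V E
  stem : S.inl.range ≤ verbalSubgroup V E
  kernel : Nonempty (Invariant V Q ≃* N)

end Extensions

end BTilde

/-!
The argument rests on one consequence of the definition of a VP cover: no nontrivial value of
`v = [[w, xᵢ], xⱼ]` lies in the kernel `L` of `E → G`
(`eq_one_of_mem_wordValues_of_mem_range`). Writing `W` for the verbal subgroup of `w`, this says that
`L` centralizes `[W, E]` and that `[W, L]` is central in `E`; by the three subgroups lemma `[L, E]`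
then centralizes `W`. So `L` is central in `E / C`, where `C = L ∩ C_E(W)`, and commutation with
elements of `W` does not see `C`. Since also `L ≤ V(E) ≤ [W, E]`, the group `L` is abelian and lies
in the derived subgroup of `E`.

Let `n` be the index of `B` in `E`, which is prime to `p`. Transfer from `E / C` to the
abelianization of `B / C` shows `aⁿ ∈ [B, B] C` for `a ∈ L` (`exists_pow_index_eq_mul`).

Let `F / R` be the canonical free presentation of the Sylow subgroup `P`, and put
`X = F / ⟨T(F) ∩ R⟩`. No nontrivial value of `v` in `X` lies in the image `R'` of `R`, so the same
commutator calculus holds for `R'` in `X`. The group `D = [W(X), R' ∩ [X, X]]` is central; it lies in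
`V(X)` by the three subgroups lemma, hence in the image of the invariant of `P`; and it is torsion,
by transfer from `X / (R' ∩ C_X(W(X)))` to `R'`. Lifting the presentation along `B → P` gives a
homomorphism `X → E`, well defined because it kills the values of `v` in `R`. If `a` is a `p`-element
of `L` and `u ∈ W(B)`, then `[u, a]ⁿ = [u, aⁿ]` is the image of an element of `D` by the preceding
paragraph, and `[u, a]` is a power of `[u, a]ⁿ`. Hence `[W(B), M]` lies in the image of `D`.

By Schur's theorem on groups with finite central quotient, `[W, L]` has only finitely many generating
commutators (`finite_commutators`), so `[W(B), M]` is finitely generated and is the image of a finite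
subgroup of the abelian torsion group `D`. A quotient of a finite abelian group embeds into that
group by duality, so `[W(B), M]` embeds into `D`, and with it into the invariant of `P`.
-/

namespace BTilde

open Subgroup
open scoped commutatorElement

/-! ### Commutators in a group -/

theorem comm_eq_commutatorElement {X : Type*} [Group X] (x y : X) : comm x y = ⁅x⁻¹, y⁻¹⁆ := by
  simp [comm, commutatorElement_def]

theorem map_comm {X Y : Type*} [Group X] [Group Y] (f : X →* Y) (x y : X) :
    f (comm x y) = comm (f x) (f y) := by
  simp [comm]

theorem commutatorElement_mem_iff_comm_mem {X : Type*} [Group X] (K : Subgroup X) [K.Normal]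
    (x y : X) : ⁅x, y⁆ ∈ K ↔ comm x y ∈ K := by
  have key : ∀ z : X, z ∈ K ↔ (QuotientGroup.mk' K) z = 1 := fun z =>
    (QuotientGroup.eq_one_iff z).symm
  rw [key, key, comm_eq_commutatorElement, map_commutatorElement, map_commutatorElement,
    commutatorElement_eq_one_iff_commute, commutatorElement_eq_one_iff_commute, map_inv, map_inv,
    Commute.inv_inv_iff]

/-- To bound `⁅⟨s⟩, T⁆` by a normal subgroup it is enough to bound the commutators of the
generators; no closure of `s` under conjugation is needed. -/
theorem closure_commutator_le {X : Type*} [Group X] (s : Set X) (T K : Subgroup X) [K.Normal]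
    (h : ∀ x ∈ s, ∀ t ∈ T, comm x t ∈ K) : ⁅closure s, T⁆ ≤ K := by
  rw [commutator_le]
  intro x hx t ht
  refine closure_induction (p := fun x _ => ⁅x, t⁆ ∈ K) ?_ ?_ ?_ ?_ hx
  · intro x hx
    exact (commutatorElement_mem_iff_comm_mem K x t).2 (h x hx t ht)
  · simp
  · intro x y _ _ hx hy
    have : ⁅x * y, t⁆ = x * ⁅y, t⁆ * x⁻¹ * ⁅x, t⁆ := by
      simp [commutatorElement_def, mul_assoc]
    rw [this]
    exact mul_mem (‹K.Normal›.conj_mem _ hy x) hx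
  · intro x _ hx
    have : ⁅x⁻¹, t⁆ = x⁻¹ * ⁅x, t⁆⁻¹ * x⁻¹⁻¹ := by
      simp [commutatorElement_def, mul_assoc]
    rw [this]
    exact ‹K.Normal›.conj_mem _ (inv_mem hx) x⁻¹

/-- A form of the three subgroups lemma. -/
theorem commutator_commutator_top_le {X : Type*} [Group X] (W K : Subgroup X) [K.Normal]
    (h : ⁅⁅W, (⊤ : Subgroup X)⁆, (⊤ : Subgroup X)⁆ ≤ K) :
    ⁅W, _root_.commutator X⁆ ≤ K := by
  set q := QuotientGroup.mk' K
  have key : ∀ Z : Subgroup X, Z ≤ K ↔ Z.map q = ⊥ := by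
    intro Z
    rw [Subgroup.map_eq_bot_iff, QuotientGroup.ker_mk']
  rw [key] at h ⊢
  rw [_root_.commutator_def, commutator_comm]
  simp only [map_commutator] at h ⊢
  refine commutator_commutator_eq_bot_of_rotate ?_ h
  rw [commutator_comm (Subgroup.map q ⊤)]
  exact h

/-- The transfer into the abelianization of a subgroup `H` of finite index sends a central element
to its power with exponent the index of `H`, and it kills the derived subgroup. -/
theorem pow_index_mem_commutator {X : Type*} [Group X] (H : Subgroup X) [H.FiniteIndex] {a : X}
    (ha : a ∈ center X) (ha' : a ∈ _root_.commutator X) : a ^ H.index ∈ ⁅H, H⁆ := by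
  have hkey : ∀ (k : ℕ) (g₀ : X), g₀⁻¹ * a ^ k * g₀ ∈ H → g₀⁻¹ * a ^ k * g₀ = a ^ k := by
    intro k g _
    rw [mul_assoc, ← (mem_center_iff.1 (pow_mem ha k) g), inv_mul_cancel_left]
  have h1 := MonoidHom.transfer_eq_pow (Abelianization.of (G := H)) a hkey
  have h2 : MonoidHom.transfer (Abelianization.of (G := H)) a = 1 :=
    Abelianization.commutator_subset_ker _ ha'
  rw [h2] at h1
  have h3 := (QuotientGroup.eq_one_iff _).1 h1.symm
  rw [← map_subtype_commutator]
  exact ⟨_, h3, rfl⟩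

/-- The transfer argument of `pow_index_mem_commutator` modulo a normal subgroup `C`, relative to
which `L` is central. -/
theorem exists_pow_index_eq_mul {X : Type*} [Group X] (L C H : Subgroup X) [C.Normal]
    [H.FiniteIndex] (hLC : ⁅L, (⊤ : Subgroup X)⁆ ≤ C) (hCH : C ≤ H) {a : X} (ha : a ∈ L)
    (ha' : a ∈ _root_.commutator X) : ∃ h ∈ ⁅H, H⁆, ∃ c ∈ C, a ^ H.index = h * c := by
  set q := QuotientGroup.mk' C
  have hq : Function.Surjective q := QuotientGroup.mk'_surjective C
  have hidx : (H.map q).index = H.index :=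
    index_map_eq H hq (by rwa [QuotientGroup.ker_mk'])
  have : (H.map q).FiniteIndex := ⟨hidx ▸ FiniteIndex.index_ne_zero⟩
  have hcen : q a ∈ center (X ⧸ C) := by
    rw [mem_center_iff]
    intro y
    obtain ⟨x, rfl⟩ := hq y
    have h : q ⁅a, x⁆ = 1 :=
      (QuotientGroup.eq_one_iff _).2 (hLC (commutator_mem_commutator ha (mem_top x)))
    rw [map_commutatorElement, commutatorElement_eq_one_iff_mul_comm] at h
    exact h.symm
  have hder : q a ∈ _root_.commutator (X ⧸ C) := by
    have h := mem_map_of_mem q ha'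
    rw [_root_.commutator_def, map_commutator] at h
    exact commutator_mono le_top le_top h
  have h := pow_index_mem_commutator (H.map q) hcen hder
  rw [hidx, ← map_commutator] at h
  obtain ⟨x, hx, hxa⟩ := h
  rw [← map_pow] at hxa
  refine ⟨x, hx, x⁻¹ * a ^ H.index, ?_, by simp⟩
  exact QuotientGroup.eq.1 hxa

section ThreeSubgroups

variable {X : Type*} [Group X] {W L : Subgroup X}

theorem commutator_top_le_inf_centralizer [L.Normal]
    (h1 : ⁅⁅W, (⊤ : Subgroup X)⁆, L⁆ = ⊥) (h2 : ⁅⁅W, L⁆, (⊤ : Subgroup X)⁆ = ⊥) :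
    ⁅L, (⊤ : Subgroup X)⁆ ≤ L ⊓ centralizer (W : Set X) := by
  refine le_inf (commutator_le_left L ⊤) ?_
  rw [← commutator_eq_bot_iff_le_centralizer]
  refine commutator_commutator_eq_bot_of_rotate ?_ h2
  rwa [commutator_comm ⊤ W]

theorem commutatorElement_pow (h2 : ⁅⁅W, L⁆, (⊤ : Subgroup X)⁆ = ⊥) {u a : X}
    (hu : u ∈ W) (ha : a ∈ L) (n : ℕ) : ⁅u, a ^ n⁆ = ⁅u, a⁆ ^ n := by
  have hcen : ∀ b ∈ L, ⁅u, b⁆ ∈ center X := fun b hb =>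
    commutator_top_right_eq_bot_iff_le_center.1 h2 (commutator_mem_commutator hu hb)
  induction n with
  | zero => simp
  | succ n ih =>
    have h : ⁅u, a ^ n * a⁆ = ⁅u, a ^ n⁆ * (a ^ n * ⁅u, a⁆ * (a ^ n)⁻¹) := by
      simp [commutatorElement_def, mul_assoc]
    rw [pow_succ, h, mem_center_iff.1 (hcen a ha) (a ^ n), mul_inv_cancel_right, ih, pow_succ]

theorem commutatorElement_mul_mul {u l a c : X} (hla : Commute l a) (huc : Commute u c)
    (hlc : Commute l c) :
    ⁅u * l, a * c⁆ = ⁅u, a⁆ := by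
  have h1 : Commute l (a * c) := hla.mul_right hlc
  have e1 : ⁅u * l, a * c⁆ = ⁅u, a * c⁆ := by
    rw [commutatorElement_def, mul_assoc u l, h1.eq]
    simp [commutatorElement_def, mul_assoc]
  have e2 : ⁅u, a * c⁆ = u * a * (c * u⁻¹) * c⁻¹ * a⁻¹ := by
    simp [commutatorElement_def, mul_assoc]
  rw [e1, e2, ← huc.inv_left.eq]
  simp [commutatorElement_def, mul_assoc]

/-- `⁅u, a⁆` depends on `u` modulo `L` only, and on `a` modulo `C = L ⊓ centralizer W` only; the
image of `L` in `X ⧸ C` is central of finite index and contained in the derived subgroup, hence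
finite by Schur's theorem. -/
theorem finite_commutators [W.Normal] [L.Normal] [Finite (X ⧸ L)]
    (h1 : ⁅⁅W, (⊤ : Subgroup X)⁆, L⁆ = ⊥) (h2 : ⁅⁅W, L⁆, (⊤ : Subgroup X)⁆ = ⊥)
    (hL : ∀ a ∈ L, ∀ b ∈ L, Commute a b) (hLX : L ≤ _root_.commutator X) :
    {x : X | ∃ u ∈ W, ∃ a ∈ L, ⁅u, a⁆ = x}.Finite := by
  set C := L ⊓ centralizer (W : Set X)
  set q := QuotientGroup.mk' C
  have hLC := commutator_top_le_inf_centralizer h1 h2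
  have hqc : ∀ a ∈ L, ∀ x, Commute (q a) (q x) := by
    intro a ha x
    rw [← commutatorElement_eq_one_iff_commute, ← map_commutatorElement]
    exact (QuotientGroup.eq_one_iff _).2 (hLC (commutator_mem_commutator ha (mem_top x)))
  have hmk : ∀ x : X, ∃ l ∈ L, x = (x : X ⧸ L).out * l := fun x =>
    ⟨(x : X ⧸ L).out⁻¹ * x, QuotientGroup.eq.1 (by simp), by simp⟩
  have : Finite (commutatorSet (X ⧸ C)) := by
    refine Set.Finite.subset (Set.finite_range
      fun t : (X ⧸ L) × (X ⧸ L) => ⁅q t.1.out, q t.2.out⁆) ?_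
    rintro _ ⟨y, z, rfl⟩
    obtain ⟨y, rfl⟩ := QuotientGroup.mk'_surjective C y
    obtain ⟨z, rfl⟩ := QuotientGroup.mk'_surjective C z
    obtain ⟨l, hl, e⟩ := hmk y
    obtain ⟨m, hm, e'⟩ := hmk z
    refine ⟨(y, z), ?_⟩
    change ⁅q _, q _⁆ = ⁅q y, q z⁆
    conv_rhs => rw [e, e', map_mul, map_mul]
    exact (commutatorElement_mul_mul (hqc l hl _) (hqc m hm _).symm (hqc l hl _)).symm
  refine Set.Finite.subset (Set.finite_range fun t : (X ⧸ L) × _root_.commutator (X ⧸ C) =>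
    ⁅t.1.out, (t.2 : X ⧸ C).out⁆) ?_
  rintro _ ⟨u, hu, a, ha, rfl⟩
  obtain ⟨l, hl, e⟩ := hmk u
  have hqa : q a ∈ _root_.commutator (X ⧸ C) := by
    have h := mem_map_of_mem q (hLX ha)
    rw [_root_.commutator_def, map_commutator] at h
    exact commutator_mono le_top le_top h
  refine ⟨(u, ⟨q a, hqa⟩), ?_⟩
  change ⁅(u : X ⧸ L).out, (q a).out⁆ = ⁅u, a⁆
  have hc : (q a).out⁻¹ * a ∈ C := QuotientGroup.eq.1 (by simp [q])
  set d := (q a).out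
  have hd : d ∈ L := by
    have := mul_mem ha (inv_mem hc.1)
    simpa using this
  set v := (u : X ⧸ L).out
  have hvc : Commute v (d⁻¹ * a) := by
    have h' : Commute u (d⁻¹ * a) := mem_centralizer_iff.1 hc.2 u hu
    have h'' := h'.mul_left (hL _ (inv_mem hl) _ hc.1)
    rwa [e, mul_inv_cancel_right] at h''
  have := commutatorElement_mul_mul (hL l hl d hd) hvc (hL l hl _ hc.1)
  rw [← this, ← e, mul_inv_cancel_left]

end ThreeSubgroups

/-! ### Finite abelian groups -/

/-- Subgroups and quotients of a finite abelian group embed into it: a quotient map dualizes to an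
injection of character groups, and a finite abelian group is isomorphic to its dual. -/
theorem exists_injective_of_surjective {D Q : Type*} [CommGroup D] [Finite D] [CommGroup Q]
    (f : D →* Q) (hf : Function.Surjective f) : ∃ g : Q →* D, Function.Injective g := by
  have : Finite Q := Finite.of_surjective f hf
  obtain ⟨eD⟩ := CommGroup.monoidHom_mulEquiv_of_hasEnoughRootsOfUnity D ℂ
  obtain ⟨eQ⟩ := CommGroup.monoidHom_mulEquiv_of_hasEnoughRootsOfUnity Q ℂ
  have hinj : Function.Injective (MonoidHom.compHom' f : (Q →* ℂˣ) →* (D →* ℂˣ)) :=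
    fun a b hab => (MonoidHom.cancel_right hf).1 hab
  exact ⟨eD.toMonoidHom.comp ((MonoidHom.compHom' f).comp eQ.symm.toMonoidHom),
    eD.injective.comp (hinj.comp eQ.symm.injective)⟩

/-- A finitely generated subgroup of the image of a torsion abelian group `D` embeds into `D`. -/
theorem exists_injective_of_le_map {X E : Type*} [Group X] [Group E] (θ : X →* E)
    (D : Subgroup X) (hcomm : ∀ a ∈ D, ∀ b ∈ D, a * b = b * a)
    (htors : ∀ a ∈ D, IsOfFinOrder a) (Q : Subgroup E) (hQ : Q.FG) (hQD : Q ≤ D.map θ) :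
    ∃ g : Q →* X, Function.Injective g ∧ ∀ x, g x ∈ D := by
  obtain ⟨s, rfl⟩ := hQ
  have hs : ∀ x : s, ∃ d ∈ D, θ d = x := fun x => hQD (subset_closure x.2)
  choose d hd hθ using hs
  set D₀ : Subgroup X := closure (Set.range d)
  have hD₀ : D₀ ≤ D := by
    rw [closure_le]
    rintro _ ⟨x, rfl⟩
    exact hd x
  let : CommGroup D₀ :=
    { mul_comm := fun a b => Subtype.ext (hcomm a (hD₀ a.2) b (hD₀ b.2)) }
  have : Group.FG D₀ := by
    rw [Group.fg_iff_subgroup_fg]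
    exact ⟨(Set.finite_range d).toFinset, by simp [D₀]⟩
  have : Finite D₀ := CommGroup.finite_of_fg_isMulTorsion _ fun x =>
    Submonoid.isOfFinOrder_coe.1 (htors x (hD₀ x.2))
  have hmap : closure (s : Set E) = D₀.map θ := by
    rw [MonoidHom.map_closure, ← Set.range_comp]
    congr 1
    ext x
    constructor
    · intro hx
      exact ⟨⟨x, hx⟩, hθ _⟩
    · rintro ⟨y, rfl⟩
      simp [hθ]
  let f : D₀ →* closure (s : Set E) :=
    (θ.comp D₀.subtype).codRestrict _ fun x => hmap ▸ mem_map_of_mem θ x.2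
  have hf : Function.Surjective f := by
    rintro ⟨y, hy⟩
    rw [hmap] at hy
    obtain ⟨x, hx, rfl⟩ := hy
    exact ⟨⟨x, hx⟩, rfl⟩
  let : CommGroup (closure (s : Set E)) :=
    { mul_comm := fun a b => by
        obtain ⟨a, rfl⟩ := hf a
        obtain ⟨b, rfl⟩ := hf b
        rw [← map_mul, ← map_mul, mul_comm] }
  obtain ⟨g, hg⟩ := exists_injective_of_surjective f hf
  exact ⟨D₀.subtype.comp g, D₀.subtype_injective.comp hg, fun x => hD₀ (g x).2⟩

/-! ### Values of the words -/

section Values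

variable {X Y : Type*} [Group X] [Group Y]

theorem map_lift (f : X →* Y) (g : ℕ → X) (v : FreeGroup ℕ) :
    f (FreeGroup.lift g v) = FreeGroup.lift (fun k => f (g k)) v := by
  have : f.comp (FreeGroup.lift g) = FreeGroup.lift fun k => f (g k) := by
    ext k
    simp
  exact DFunLike.congr_fun this v

theorem mem_wordValues_singleton {v : FreeGroup ℕ} {x : X} :
    x ∈ wordValues {v} X ↔ ∃ g : ℕ → X, FreeGroup.lift g v = x := by
  simp [wordValues]

theorem map_mem_wordValues (V : Set (FreeGroup ℕ)) (f : X →* Y) {x : X}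
    (hx : x ∈ wordValues V X) : f x ∈ wordValues V Y := by
  obtain ⟨v, hv, g, rfl⟩ := hx
  exact ⟨v, hv, fun k => f (g k), (map_lift f g v).symm⟩

theorem map_verbalSubgroup_le (V : Set (FreeGroup ℕ)) (f : X →* Y) :
    (verbalSubgroup V X).map f ≤ verbalSubgroup V Y := by
  rw [verbalSubgroup, MonoidHom.map_closure, closure_le]
  rintro _ ⟨x, hx, rfl⟩
  exact subset_closure (map_mem_wordValues V f hx)

theorem exists_wordValues_of_surjective (V : Set (FreeGroup ℕ)) {f : X →* Y}
    (hf : Function.Surjective f) {y : Y} (hy : y ∈ wordValues V Y) :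
    ∃ x ∈ wordValues V X, f x = y := by
  obtain ⟨v, hv, g, rfl⟩ := hy
  choose σ hσ using hf
  exact ⟨_, ⟨v, hv, fun k => σ (g k), rfl⟩, by simp [map_lift, hσ]⟩

theorem map_verbalSubgroup_of_surjective (V : Set (FreeGroup ℕ)) {f : X →* Y}
    (hf : Function.Surjective f) : (verbalSubgroup V X).map f = verbalSubgroup V Y := by
  refine le_antisymm (map_verbalSubgroup_le V f) ?_
  rw [verbalSubgroup, closure_le]
  intro y hy
  obtain ⟨x, hx, rfl⟩ := exists_wordValues_of_surjective V hf hy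
  exact mem_map_of_mem f (subset_closure hx)

instance verbalSubgroup_normal (V : Set (FreeGroup ℕ)) : (verbalSubgroup V X).Normal :=
  ⟨fun _ hx g => map_verbalSubgroup_le V (MulAut.conj g).toMonoidHom (mem_map_of_mem _ hx)⟩

theorem IsOuterCommutatorWord.lift_congr {A : Finset ℕ} {w : FreeGroup ℕ}
    (hw : IsOuterCommutatorWord A w) {g h : ℕ → X} (hgh : ∀ k ∈ A, g k = h k) :
    FreeGroup.lift g w = FreeGroup.lift h w := by
  induction hw with
  | var i => simpa using hgh i (by simp)
  | comm _ _ _ ihu ihv =>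
    rw [map_comm, map_comm, ihu fun k hk => hgh k (Finset.mem_union_left _ hk),
      ihv fun k hk => hgh k (Finset.mem_union_right _ hk)]

end Values

/-- The word `[[w, xᵢ], xⱼ]`. -/
def doubleCommutatorWord (w : FreeGroup ℕ) (i j : ℕ) : FreeGroup ℕ :=
  comm (comm w (FreeGroup.of i)) (FreeGroup.of j)

section DoubleCommutator

variable {A : Finset ℕ} {w : FreeGroup ℕ} {i j : ℕ} {X : Type*} [Group X]

theorem lift_doubleCommutatorWord (g : ℕ → X) :
    FreeGroup.lift g (doubleCommutatorWord w i j)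
      = comm (comm (FreeGroup.lift g w) (g i)) (g j) := by
  simp [doubleCommutatorWord, map_comm]

theorem comm_comm_mem_wordValues (hw : IsOuterCommutatorWord A w) (hi : i ∉ A) (hj : j ∉ A)
    (hij : i ≠ j) {u : X} (hu : u ∈ wordValues {w} X) (x y : X) :
    comm (comm u x) y ∈ wordValues {doubleCommutatorWord w i j} X := by
  obtain ⟨_, rfl, g, rfl⟩ := hu
  refine ⟨_, rfl, Function.update (Function.update g i x) j y, ?_⟩
  rw [lift_doubleCommutatorWord, hw.lift_congr (h := g)]
  · simp [Function.update_of_ne hij]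
  · intro k hk
    rw [Function.update_of_ne (by rintro rfl; exact hj hk),
      Function.update_of_ne (by rintro rfl; exact hi hk)]

theorem verbalSubgroup_doubleCommutatorWord_le :
    verbalSubgroup {doubleCommutatorWord w i j} X
      ≤ ⁅verbalSubgroup {w} X, (⊤ : Subgroup X)⁆ := by
  rw [verbalSubgroup, closure_le]
  rintro _ ⟨_, rfl, g, rfl⟩
  rw [lift_doubleCommutatorWord]
  refine (commutatorElement_mem_iff_comm_mem _ _ _).1 ?_
  refine commutator_le_left _ ⊤ (commutator_mem_commutator ?_ (mem_top _))
  refine (commutatorElement_mem_iff_comm_mem _ _ _).1 ?_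
  exact commutator_mem_commutator (subset_closure ⟨w, rfl, g, rfl⟩) (mem_top _)

theorem commutator_verbalSubgroup_commutator_le (hw : IsOuterCommutatorWord A w) (hi : i ∉ A)
    (hj : j ∉ A) (hij : i ≠ j) :
    ⁅verbalSubgroup {w} X, _root_.commutator X⁆
      ≤ verbalSubgroup {doubleCommutatorWord w i j} X := by
  set K := verbalSubgroup {doubleCommutatorWord w i j} X
  apply commutator_commutator_top_le
  -- modulo `K`, every `comm u x` with `u` a value of `w` is central
  have hcen : ⁅verbalSubgroup {w} X, (⊤ : Subgroup X)⁆
      ≤ (center (X ⧸ K)).comap (QuotientGroup.mk' K) := by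
    refine closure_commutator_le _ _ _ fun u hu x _ => ?_
    rw [mem_comap, mem_center_iff]
    intro y
    obtain ⟨y, rfl⟩ := QuotientGroup.mk'_surjective K y
    refine Eq.symm ?_
    rw [← commutatorElement_eq_one_iff_mul_comm, ← map_commutatorElement]
    refine (QuotientGroup.eq_one_iff _).2 ?_
    rw [commutatorElement_mem_iff_comm_mem]
    exact subset_closure (comm_comm_mem_wordValues hw hi hj hij hu x y)
  rw [commutator_le]
  intro x hx y _
  have h := mem_center_iff.1 (hcen hx) (QuotientGroup.mk' K y)
  rw [← QuotientGroup.eq_one_iff (N := K)]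
  change QuotientGroup.mk' K ⁅x, y⁆ = 1
  rw [map_commutatorElement, commutatorElement_eq_one_iff_mul_comm]
  exact h.symm

variable {L : Subgroup X} [L.Normal]

theorem commutator_commutator_top_eq_bot (hw : IsOuterCommutatorWord A w) (hi : i ∉ A)
    (hj : j ∉ A) (hij : i ≠ j)
    (hL : ∀ x ∈ wordValues {doubleCommutatorWord w i j} X, x ∈ L → x = 1) :
    ⁅⁅verbalSubgroup {w} X, (⊤ : Subgroup X)⁆, L⁆ = ⊥ := by
  rw [commutator_eq_bot_iff_le_centralizer]
  refine closure_commutator_le _ _ _ fun u hu x _ => ?_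
  rw [mem_centralizer_iff]
  intro a ha
  refine Eq.symm ?_
  rw [← commutatorElement_eq_one_iff_mul_comm, ← mem_bot,
    commutatorElement_mem_iff_comm_mem, mem_bot]
  refine hL _ (comm_comm_mem_wordValues hw hi hj hij hu x a) ?_
  rw [← commutatorElement_mem_iff_comm_mem]
  exact commutator_le_right ⊤ L (commutator_mem_commutator (mem_top _) ha)

theorem commutator_commutator_eq_bot (hw : IsOuterCommutatorWord A w) (hi : i ∉ A)
    (hj : j ∉ A) (hij : i ≠ j)
    (hL : ∀ x ∈ wordValues {doubleCommutatorWord w i j} X, x ∈ L → x = 1) :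
    ⁅⁅verbalSubgroup {w} X, L⁆, (⊤ : Subgroup X)⁆ = ⊥ := by
  rw [commutator_top_right_eq_bot_iff_le_center]
  refine closure_commutator_le _ _ _ fun u hu a ha => ?_
  rw [mem_center_iff]
  intro y
  refine Eq.symm ?_
  rw [← commutatorElement_eq_one_iff_mul_comm, ← mem_bot,
    commutatorElement_mem_iff_comm_mem, mem_bot]
  refine hL _ (comm_comm_mem_wordValues hw hi hj hij hu a y) ?_
  rw [← commutatorElement_mem_iff_comm_mem]
  refine commutator_le_left L ⊤ (commutator_mem_commutator ?_ (mem_top _))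
  rw [← commutatorElement_mem_iff_comm_mem]
  exact commutator_le_right ⊤ L (commutator_mem_commutator (mem_top _) ha)

end DoubleCommutator

/-! ### The commutators of `W` with the derived part of `L` -/

theorem commutator_inf_commutator_le_center {X : Type*} [Group X] {W L : Subgroup X}
    (h2 : ⁅⁅W, L⁆, (⊤ : Subgroup X)⁆ = ⊥) :
    ⁅W, L ⊓ _root_.commutator X⁆ ≤ center X :=
  (commutator_mono le_rfl inf_le_left).trans (commutator_top_right_eq_bot_iff_le_center.1 h2)

section FiniteIndex

variable {X : Type*} [Group X] {W L : Subgroup X} [W.Normal] [L.Normal]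

/-- Modulo `L ⊓ centralizer W` the subgroup `L` is central of finite index, so by transfer the
index annihilates its intersection with the derived subgroup. -/
theorem commutatorElement_pow_index_eq_one [L.FiniteIndex]
    (h1 : ⁅⁅W, (⊤ : Subgroup X)⁆, L⁆ = ⊥) (h2 : ⁅⁅W, L⁆, (⊤ : Subgroup X)⁆ = ⊥) {u r : X}
    (hu : u ∈ W) (hr : r ∈ L) (hr' : r ∈ _root_.commutator X) : ⁅u, r⁆ ^ L.index = 1 := by
  have hLC := commutator_top_le_inf_centralizer h1 h2
  obtain ⟨h, hh, c, hc, e⟩ := exists_pow_index_eq_mul L _ L hLC inf_le_left hr hr'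
  have hmem : r ^ L.index ∈ L ⊓ centralizer (W : Set X) := by
    rw [e]
    exact mul_mem (hLC (commutator_mono le_rfl le_top hh)) hc
  rw [← commutatorElement_pow h2 hu hr, commutatorElement_eq_one_iff_mul_comm]
  exact mem_centralizer_iff.1 hmem.2 u hu

theorem isOfFinOrder_of_mem_commutator_inf [L.FiniteIndex]
    (h1 : ⁅⁅W, (⊤ : Subgroup X)⁆, L⁆ = ⊥) (h2 : ⁅⁅W, L⁆, (⊤ : Subgroup X)⁆ = ⊥) {d : X}
    (hd : d ∈ ⁅W, L ⊓ _root_.commutator X⁆) : IsOfFinOrder d := by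
  have hcen := commutator_inf_commutator_le_center h2
  refine isOfFinOrder_iff_pow_eq_one.2
    ⟨L.index, Nat.pos_of_ne_zero FiniteIndex.index_ne_zero, ?_⟩
  rw [Subgroup.commutator_def] at hd hcen
  refine closure_induction (p := fun d _ => d ^ L.index = 1) ?_ (one_pow _) ?_ ?_ hd
  · rintro _ ⟨u, hu, r, hr, rfl⟩
    exact commutatorElement_pow_index_eq_one h1 h2 hu hr.1 hr.2
  · intro x y _ hy hx' hy'
    rw [(show Commute x y from mem_center_iff.1 (hcen hy) x).mul_pow, hx', hy', one_mul]
  · intro x _ hx'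
    rw [inv_pow, hx', inv_one]

end FiniteIndex

/-! ### Embeddings into the invariant -/

section Presentation

variable (V : Set (FreeGroup ℕ)) {F Q : Type*} [Group F] [Group Q] (π : F →* Q)

theorem trivialValues_le_ker : trivialValues V π ≤ π.ker := by
  rw [trivialValues, closure_le]
  exact Set.inter_subset_right

/-- In `F / ⟨T(F) ∩ R⟩` no nontrivial value of the words lies in the image of `R`. -/
theorem eq_one_of_mem_wordValues_quotient {x : F ⧸ trivialValues V π}
    (hx : x ∈ wordValues V (F ⧸ trivialValues V π))
    (hx' : x ∈ π.ker.map (QuotientGroup.mk' (trivialValues V π))) : x = 1 := by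
  obtain ⟨f, hf, rfl⟩ :=
    exists_wordValues_of_surjective V (QuotientGroup.mk'_surjective (trivialValues V π)) hx
  obtain ⟨r, hr, e⟩ := hx'
  have hfr : f ∈ π.ker := by
    have h := mul_mem hr (trivialValues_le_ker V π (QuotientGroup.eq.1 e))
    simpa using h
  exact (QuotientGroup.eq_one_iff f).2 (subset_closure ⟨hf, hfr⟩)

end Presentation

theorem exists_subgroup_invariant (V : Set (FreeGroup ℕ)) {P Q : Type*} [Group P] [Group Q]
    (g : Q →* FreeGroup P ⧸ trivialValues V (presentation P)) (hg : Function.Injective g)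
    (hker : ∀ x, g x ∈ (presentation P).ker.map
      (QuotientGroup.mk' (trivialValues V (presentation P))))
    (hV : ∀ x, g x ∈ verbalSubgroup V (FreeGroup P ⧸ trivialValues V (presentation P))) :
    ∃ K : Subgroup (Invariant V P), Nonempty (Q ≃* K) := by
  set N := trivialValues V (presentation P)
  set I := (presentation P).ker ⊓ verbalSubgroup V (FreeGroup P)
  let ι : Invariant V P →* FreeGroup P ⧸ N :=
    QuotientGroup.map (N.subgroupOf I) N I.subtype le_rfl
  have hι : Function.Injective ι := by
    rw [injective_iff_map_eq_one]
    intro x hx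
    obtain ⟨x, rfl⟩ := QuotientGroup.mk_surjective x
    exact (QuotientGroup.eq_one_iff x).2 ((QuotientGroup.eq_one_iff (x : FreeGroup P)).1 hx)
  have hrange : ∀ x, g x ∈ ι.range := by
    intro x
    have h := hV x
    rw [← map_verbalSubgroup_of_surjective V (QuotientGroup.mk'_surjective N)] at h
    obtain ⟨f, hf, e⟩ := h
    obtain ⟨r, hr, e'⟩ := hker x
    have hfr : f ∈ (presentation P).ker := by
      have h := mul_mem hr
        (trivialValues_le_ker V (presentation P) (QuotientGroup.eq.1 (e'.trans e.symm)))
      simpa using h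
    exact ⟨QuotientGroup.mk ⟨f, hfr, hf⟩, e⟩
  let k : Q →* Invariant V P :=
    (MonoidHom.ofInjective hι).symm.toMonoidHom.comp (g.codRestrict ι.range hrange)
  have hk : Function.Injective k :=
    (MonoidHom.ofInjective hι).symm.injective.comp
      fun a b hab => hg (congrArg Subtype.val hab)
  exact ⟨k.range, ⟨MonoidHom.ofInjective hk⟩⟩

/-! ### The main argument -/

/-- In a marginal VP extension the kernel contains no nontrivial value of the word `v`: a value in
the kernel is trivial in the quotient, so it is trivial at some lift of the same arguments, and by
marginality all lifts give the same value. -/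
theorem eq_one_of_mem_wordValues_of_mem_range {A : Finset ℕ} {v : FreeGroup ℕ}
    (hv : IsOuterCommutatorWord A v) {N E G : Type*} [Group N] [Group E] [Group G]
    (S : GroupExtension N E G) (hvp : IsVPExtension {v} S)
    (hmarg : S.inl.range ≤ marginalSubgroup {v} E) {x : E} (hx : x ∈ wordValues {v} E)
    (hx' : x ∈ S.inl.range) : x = 1 := by
  obtain ⟨g, rfl⟩ := mem_wordValues_singleton.1 hx
  rw [S.range_inl_eq_ker_rightHom, MonoidHom.mem_ker, map_lift] at hx'
  obtain ⟨e, he, hev⟩ := hvp _ rfl _ hx'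
  rw [← hev]
  -- marginality changes one argument at a time, so the arguments are replaced along a finite set
  have key : ∀ s : Finset ℕ, FreeGroup.lift (fun k => if k ∈ s then e k else g k) v
      = FreeGroup.lift g v := by
    intro s
    induction s using Finset.induction_on with
    | empty => simp
    | insert m s hm ih =>
      have hl : (g m)⁻¹ * e m ∈ S.inl.range := by
        rw [S.range_inl_eq_ker_rightHom, MonoidHom.mem_ker, map_mul, map_inv, he m,
          inv_mul_cancel]
      rw [← ih, ← hmarg hl v rfl (fun k => if k ∈ s then e k else g k) m]
      congr 2
      ext k
      rcases eq_or_ne k m with rfl | hk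
      · simp [hm]
      · simp [hk]
  rw [← key A]
  exact hv.lift_congr fun k hk => by simp [hk]

/-- The embedding of `⁅W(B), M⁆`, for a normal subgroup `L` of finite index that meets the set of
values of `[[w, xᵢ], xⱼ]` trivially and lies in the verbal subgroup, and a subgroup `M` of `L` all
of whose elements have order a power of a prime not dividing the index of `B`. -/
theorem exists_commutator_equiv_subgroup_invariant {A : Finset ℕ} {w : FreeGroup ℕ}
    (hw : IsOuterCommutatorWord A w) {i j : ℕ} (hi : i ∉ A) (hj : j ∉ A) (hij : i ≠ j)
    {E P : Type*} [Group E] [Group P] [Finite P] (L : Subgroup E) [L.Normal] [Finite (E ⧸ L)]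
    (hsep : ∀ x ∈ wordValues {doubleCommutatorWord w i j} E, x ∈ L → x = 1)
    (hstem : L ≤ verbalSubgroup {doubleCommutatorWord w i j} E)
    (B : Subgroup E) (hLB : L ≤ B) (e : (B ⧸ L.subgroupOf B) ≃* P)
    {p : ℕ} (hp : p.Coprime B.index) (M : Subgroup E) (hML : M ≤ L)
    (hM : ∀ a ∈ M, ∃ k : ℕ, a ^ p ^ k = 1) :
    ∃ K : Subgroup (Invariant {doubleCommutatorWord w i j} P),
      Nonempty ((⁅(verbalSubgroup {w} B).map B.subtype, M⁆ : Subgroup E) ≃* K) := by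
  set V : Set (FreeGroup ℕ) := {doubleCommutatorWord w i j}
  set W := verbalSubgroup {w} E
  have h1 : ⁅⁅W, (⊤ : Subgroup E)⁆, L⁆ = ⊥ :=
    commutator_commutator_top_eq_bot hw hi hj hij hsep
  have h2 : ⁅⁅W, L⁆, (⊤ : Subgroup E)⁆ = ⊥ := commutator_commutator_eq_bot hw hi hj hij hsep
  have hLW : L ≤ ⁅W, (⊤ : Subgroup E)⁆ := hstem.trans verbalSubgroup_doubleCommutatorWord_le
  have hLX : L ≤ _root_.commutator E := hLW.trans (commutator_mono le_top le_rfl)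
  have hLab : ∀ a ∈ L, ∀ b ∈ L, Commute a b := fun a ha b hb =>
    (mem_centralizer_iff.1 (commutator_eq_bot_iff_le_centralizer.1 h1 (hLW ha)) b hb).symm
  have hLC := commutator_top_le_inf_centralizer h1 h2
  set C := L ⊓ centralizer (W : Set E)
  have : L.FiniteIndex := finiteIndex_of_finite_quotient
  have : B.FiniteIndex := finiteIndex_of_le hLB
  have hWB : (verbalSubgroup {w} B).map B.subtype ≤ W := map_verbalSubgroup_le _ _
  -- the presentation of `P` lifts to a homomorphism into `B`
  have hb : ∀ x : P, ∃ b : B, e (b : B ⧸ L.subgroupOf B) = x := fun x => by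
    obtain ⟨b, hb⟩ := QuotientGroup.mk_surjective (e.symm x)
    exact ⟨b, by rw [hb, e.apply_symm_apply]⟩
  choose b hb using hb
  let πB : FreeGroup P →* B := FreeGroup.lift b
  let π : FreeGroup P →* E := B.subtype.comp πB
  have hπ : ∀ f, e (πB f : B ⧸ L.subgroupOf B) = presentation P f := by
    have : (e.toMonoidHom.comp (QuotientGroup.mk' (L.subgroupOf B))).comp πB
        = presentation P := by
      ext x
      simp [πB, hb]
    exact DFunLike.congr_fun this
  have hker : ∀ f, f ∈ (presentation P).ker ↔ π f ∈ L := by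
    intro f
    rw [MonoidHom.mem_ker, ← hπ, map_eq_one_iff e e.injective, QuotientGroup.eq_one_iff]
    rfl
  have hsurj : ∀ y : B, ∃ f, (π f)⁻¹ * y ∈ L := by
    intro y
    refine ⟨FreeGroup.of (e y), ?_⟩
    have h : e (πB (FreeGroup.of (e y)) : B ⧸ L.subgroupOf B) = e y := by
      rw [hπ]
      simp
    have h' := QuotientGroup.eq.1 (e.injective h)
    exact h'
  -- `X = F / ⟨T(F) ∩ R⟩`; the lifted presentation factors through it because `L` contains no
  -- nontrivial value of the word
  let N := trivialValues V (presentation P)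
  let X := FreeGroup P ⧸ N
  let q : FreeGroup P →* X := QuotientGroup.mk' N
  have hN : N ≤ π.ker := by
    refine (closure_le _).2 fun f hf => ?_
    exact hsep _ (map_mem_wordValues V π hf.1) ((hker f).1 hf.2)
  let θ : X →* E := QuotientGroup.lift N π hN
  let R : Subgroup X := (presentation P).ker.map q
  have hR : R.Normal := Normal.map inferInstance q (QuotientGroup.mk'_surjective N)
  have hRsep : ∀ x ∈ wordValues V X, x ∈ R → x = 1 := fun x hx hx' =>
    eq_one_of_mem_wordValues_quotient V (presentation P) hx hx'
  have k1 := commutator_commutator_top_eq_bot hw hi hj hij hRsep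
  have k2 := commutator_commutator_eq_bot hw hi hj hij hRsep
  have : R.FiniteIndex := by
    refine ⟨?_⟩
    rw [index_map_eq _ (QuotientGroup.mk'_surjective N)
      (by rw [QuotientGroup.ker_mk']; exact trivialValues_le_ker V _)]
    exact FiniteIndex.index_ne_zero
  set D := ⁅verbalSubgroup {w} X, R ⊓ _root_.commutator X⁆
  have hDcen : D ≤ center X := commutator_inf_commutator_le_center k2
  -- `⁅W(B), M⁆` is finitely generated
  have hfg : (⁅(verbalSubgroup {w} B).map B.subtype, M⁆).FG := by
    have hfin := finite_commutators h1 h2 hLab hLX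
    have hsub : {x : E | ∃ u ∈ (verbalSubgroup {w} B).map B.subtype, ∃ a ∈ M, ⁅u, a⁆ = x}.Finite :=
      hfin.subset fun x ⟨u, hu, a, ha, hx⟩ => ⟨u, hWB hu, a, hML ha, hx⟩
    exact ⟨hsub.toFinset, by rw [Set.Finite.coe_toFinset, Subgroup.commutator_def]⟩
  have hlift : ⁅(verbalSubgroup {w} B).map B.subtype, M⁆ ≤ D.map θ := by
    rw [commutator_le]
    intro u hu a ha
    -- `W(B)` is the image of `W(F)` up to elements of `L`
    have hWπ : (verbalSubgroup {w} B).map B.subtype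
        ≤ (verbalSubgroup {w} (FreeGroup P)).map π ⊔ L := by
      rw [verbalSubgroup, MonoidHom.map_closure, closure_le]
      rintro _ ⟨_, hg, rfl⟩
      obtain ⟨g, rfl⟩ := mem_wordValues_singleton.1 hg
      choose f hf using fun k => hsurj (g k)
      have hmem : (π (FreeGroup.lift f w))⁻¹ * B.subtype (FreeGroup.lift g w) ∈ L := by
        rw [map_lift, map_lift]
        refine QuotientGroup.eq.1 ?_
        change QuotientGroup.mk' L _ = QuotientGroup.mk' L _
        rw [map_lift, map_lift]
        congr 2
        ext k
        exact QuotientGroup.eq.2 (hf k)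
      have hfw : FreeGroup.lift f w ∈ verbalSubgroup {w} (FreeGroup P) :=
        subset_closure (mem_wordValues_singleton.2 ⟨f, rfl⟩)
      have := mul_mem_sup (mem_map_of_mem π hfw) hmem
      rwa [mul_inv_cancel_left] at this
    obtain ⟨_, ⟨u', hu', rfl⟩, l, hl, rfl⟩ := mem_sup_of_normal_right.1 (hWπ hu)
    -- by transfer, `a ^ [E : B]` is the image of an element of `R ∩ F'` up to elements of `C`
    obtain ⟨h, hh, c, hc, hac⟩ :=
      exists_pow_index_eq_mul L C B hLC (inf_le_left.trans hLB) (hML ha) (hLX (hML ha))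
    have hBC : ⁅B, B⁆ ≤ (_root_.commutator (FreeGroup P)).map π ⊔ C := by
      rw [commutator_le]
      intro x hx y hy
      obtain ⟨f, hf⟩ := hsurj ⟨x, hx⟩
      obtain ⟨g, hg⟩ := hsurj ⟨y, hy⟩
      have hq : ∀ m ∈ L, ∀ z, Commute (QuotientGroup.mk' C m) (QuotientGroup.mk' C z) := by
        intro m hm z
        rw [← commutatorElement_eq_one_iff_commute, ← map_commutatorElement]
        exact (QuotientGroup.eq_one_iff _).2 (hLC (commutator_mem_commutator hm (mem_top z)))
      have hmem : (π ⁅f, g⁆)⁻¹ * ⁅x, y⁆ ∈ C := by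
        refine QuotientGroup.eq.1 ?_
        change QuotientGroup.mk' C _ = QuotientGroup.mk' C _
        have h := commutatorElement_mul_mul (u := QuotientGroup.mk' C (π f))
          (hq _ hf (π g)) (hq _ hg (π f)).symm (hq _ hf _)
        rw [← map_mul, ← map_mul, mul_inv_cancel_left, mul_inv_cancel_left] at h
        rw [map_commutatorElement, map_commutatorElement, map_commutatorElement]
        exact h.symm
      have := mul_mem_sup (mem_map_of_mem π
        (commutator_mem_commutator (mem_top f) (mem_top g))) hmem
      rwa [mul_inv_cancel_left] at this
    obtain ⟨_, ⟨r, hr, rfl⟩, c', hc', rfl⟩ := mem_sup_of_normal_right.1 (hBC hh)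
    rw [mul_assoc] at hac
    have hcc : c' * c ∈ C := mul_mem hc' hc
    have hrL : π r ∈ L := by
      have := mul_mem (pow_mem (hML ha) B.index) (inv_mem hcc.1)
      rwa [hac, mul_inv_cancel_right] at this
    have huW := hWB hu
    have hpow : ⁅π u' * l, a⁆ ^ B.index = θ ⁅q u', q r⁆ := by
      have hcu : Commute (π u') (c' * c) :=
        mem_centralizer_iff.1 hcc.2 _ (map_verbalSubgroup_le {w} π (mem_map_of_mem π hu'))
      rw [← commutatorElement_pow h2 huW (hML ha), hac,
        commutatorElement_mul_mul (hLab l hl _ hrL) hcu (hLab l hl _ hcc.1),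
        map_commutatorElement]
      rfl
    have hmemD : ⁅q u', q r⁆ ∈ D := by
      refine commutator_mem_commutator (map_verbalSubgroup_le {w} q (mem_map_of_mem q hu'))
        ⟨mem_map_of_mem q ((hker r).2 hrL), ?_⟩
      have h := mem_map_of_mem q hr
      rw [_root_.commutator_def, map_commutator] at h
      exact commutator_mono le_top le_top h
    -- `⁅u, a⁆` has order a power of `p`, hence it is a power of its own `[E : B]`-th power
    obtain ⟨k, hk⟩ := hM a ha
    have hord : ⁅π u' * l, a⁆ ^ p ^ k = 1 := by
      rw [← commutatorElement_pow h2 huW (hML ha), hk, commutatorElement_one_right]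
    have hcop : (orderOf ⁅π u' * l, a⁆).Coprime B.index :=
      Nat.Coprime.coprime_dvd_left (orderOf_dvd_of_pow_eq_one hord) (hp.pow_left k)
    obtain ⟨m, hm⟩ := exists_pow_eq_self_of_coprime hcop.symm
    rw [← hm, hpow]
    exact pow_mem (mem_map_of_mem θ hmemD) m
  obtain ⟨g, hg, hgD⟩ := exists_injective_of_le_map θ D
    (fun a _ b hb => mem_center_iff.1 (hDcen hb) a)
    (fun a ha => isOfFinOrder_of_mem_commutator_inf k1 k2 ha) _ hfg hlift
  refine exists_subgroup_invariant V g hg (fun x => ?_) fun x => ?_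
  · have h : D ≤ R := (commutator_mono le_rfl inf_le_left).trans (commutator_le_right _ R)
    exact h (hgD x)
  · exact commutator_verbalSubgroup_commutator_le hw hi hj hij
      (commutator_mono le_rfl inf_le_right (hgD x))

end BTilde

theorem corollary3p5
    (A : Finset ℕ) (w : FreeGroup ℕ) (hw : BTilde.IsOuterCommutatorWord A w)
    (i j : ℕ) (hi : i ∉ A) (hj : j ∉ A) (hij : i ≠ j)
    (V : Set (FreeGroup ℕ))
    (hV : V = {BTilde.comm (BTilde.comm w (FreeGroup.of i)) (FreeGroup.of j)})
    {G L E : Type*} [Group G] [Finite G] [Group L] [Group E]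
    (S : GroupExtension L E G) (hS : BTilde.IsVPCover V S)
    (p : ℕ) (hp : p.Prime) (P : Sylow p G)
    (B : Subgroup E) (hLB : S.inl.range ≤ B)
    (hB : Nonempty ((↥B ⧸ S.inl.range.subgroupOf B) ≃* P))
    (φ : BTilde.Invariant V G ≃* L) (M : Sylow p (BTilde.Invariant V G)) :
    ∃ K : Subgroup (BTilde.Invariant V P),
      Nonempty
        (↥⁅(BTilde.verbalSubgroup {w} B).map B.subtype,
            ((M : Subgroup (BTilde.Invariant V G)).map φ.toMonoidHom).map S.inl⁆ ≃* K) := by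
  subst hV
  obtain ⟨e⟩ := hB
  have : Fact p.Prime := ⟨hp⟩
  have hv : BTilde.IsOuterCommutatorWord (A ∪ {i} ∪ {j})
      (BTilde.comm (BTilde.comm w (FreeGroup.of i)) (FreeGroup.of j)) :=
    .comm (.comm hw (.var i) (by simpa using hi)) (.var j) (by simp [hj, Ne.symm hij])
  have hnorm : S.inl.range.Normal := by
    rw [S.range_inl_eq_ker_rightHom]
    infer_instance
  have hindex : S.inl.range.index = Nat.card G := by
    rw [S.range_inl_eq_ker_rightHom, Subgroup.index_ker,
      MonoidHom.range_eq_top.2 S.rightHom_surjective, Subgroup.card_top]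
  have hfin : Finite (E ⧸ S.inl.range) :=
    (Nat.card_pos_iff.1 (Nat.card_pos.trans_eq hindex.symm)).2
  -- `B` has the same index in `E` as the Sylow subgroup `P` in `G`
  have hidx : B.index = (P : Subgroup G).index := by
    have h1 := Subgroup.relIndex_mul_index hLB
    have h2 := (P : Subgroup G).card_mul_index
    have h3 : S.inl.range.relIndex B = Nat.card P := Nat.card_congr e.toEquiv
    rw [hindex, h3, ← h2] at h1
    exact Nat.eq_of_mul_eq_mul_left Nat.card_pos h1
  have hcop : p.Coprime B.index := by
    rw [hidx, hp.coprime_iff_not_dvd]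
    exact P.not_dvd_index
  refine BTilde.exists_commutator_equiv_subgroup_invariant hw hi hj hij S.inl.range
    (fun x hx hx' => BTilde.eq_one_of_mem_wordValues_of_mem_range hv S hS.vp hS.marginal hx hx')
    hS.stem B hLB e hcop _ ?_ ?_
  · rintro _ ⟨l, _, rfl⟩
    exact ⟨l, rfl⟩
  · rintro _ ⟨_, ⟨m, hm, rfl⟩, rfl⟩
    obtain ⟨k, hk⟩ := M.isPGroup' ⟨m, hm⟩
    refine ⟨k, ?_⟩
    have hk' : m ^ p ^ k = 1 := congrArg Subtype.val hk
    rw [← map_pow, ← map_pow, hk', map_one, map_one]
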